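/- A skew brace is a set $A$ with two group structures $(A,+)$ and $(A,\circ)$ (neither assumed commutative) such that $a\circ(b+c)=a\circ b-a+a\circ c$ for all $a,b,c\in A$; it is two-sided if moreover $(a+b)\circ c=a\circ c-c+b\circ c$ for all $a,b,c\in A$. Put $a*b=-a+a\circ b-b$, and for subsets $X,Y\subseteq A$ let $X*Y$ be the subgroup of $(A,+)$ generated by all $x*y$ with $x\in X$, $y\in Y$. Let $A^{[1]}=A$ and, for $n\ge 1$, let $A^{[n+1]}$ be the subgroup of $(A,+)$ generated by $\bigcup_{1\le i\le n}A^{[i]}*A^{[n+1-i]}$; $A$ is strongly nilpotent if $A^{[n]}=\{0\}$ for some $n\ge 1$. A group satisfies the maximum condition on subgroups if it has no infinite strictly ascending chain of subgroups. Theorem. Let $A$ be a two-sided skew brace such that $(A,+)$ or $(A,\circ)$ satisfies the maximum condition on subgroups. If $(A,+)$ is nilpotent, then $(A,\circ)$ is nilpotent and $A$ is a strongly nilpotent skew brace. -/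

import Mathlib

/-- A skew (left) brace `(A, +, ∘)`: two group structures on the same set `A`.
The additive group, which need not be commutative, is written `+`;
the circle operation `∘` of the multiplicative group is written `*`. -/
class SkewBrace (A : Type*) extends AddGroup A, Group A where
  /-- `a ∘ (b + c) = a ∘ b - a + a ∘ c` -/
  mul_add_eq : ∀ a b c : A, a * (b + c) = a * b - a + a * c

namespace SkewBrace

/-- A skew brace is two-sided if also `(a + b) ∘ c = a ∘ c - c + b ∘ c` for all `a, b, c`. -/
def IsTwoSided (A : Type*) [SkewBrace A] : Prop :=
  ∀ a b c : A, (a + b) * c = a * c - c + b * c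

/-- The operation usually denoted by an asterisk: `-a + a ∘ b - b`. -/
def star {A : Type*} [SkewBrace A] (a b : A) : A :=
  -a + a * b - b

/-- For subsets `X`, `Y` of `A`, the additive subgroup generated by all
`star x y` with `x ∈ X` and `y ∈ Y`. -/
def starSubgroup {A : Type*} [SkewBrace A] (X Y : Set A) : AddSubgroup A :=
  AddSubgroup.closure {z : A | ∃ x ∈ X, ∃ y ∈ Y, star x y = z}

/-- The series defining strong nilpotency, with indices shifted by one:
`strongSeries A n` is `A^[n+1]`. So `A^[1] = A`, and `A^[n+2]` is the additive subgroup generated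
by the union of the subgroups obtained from `A^[i+1]` and `A^[n-i+1]` for `0 ≤ i ≤ n`. -/
def strongSeries (A : Type*) [SkewBrace A] : ℕ → AddSubgroup A
  | 0 => ⊤
  | n + 1 => AddSubgroup.closure
      (⋃ i : Fin (n + 1),
        (starSubgroup (strongSeries A i : Set A) (strongSeries A (n - i) : Set A) : Set A))
termination_by n => n
decreasing_by all_goals omega

/-- `A` is strongly nilpotent if `A^[n] = {0}` for some `n ≥ 1`. -/
def IsStronglyNilpotent (A : Type*) [SkewBrace A] : Prop :=
  ∃ n : ℕ, strongSeries A n = ⊥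

end SkewBrace

/-- The additive subgroup generated by all `φ x - x` with `φ ∈ Γ` and `x ∈ X`. -/
def AddSubgroup.opCommutator {G : Type*} [AddGroup G] (Γ : Set (G →+ G)) (X : AddSubgroup G) :
    AddSubgroup G :=
  AddSubgroup.closure {z : G | ∃ φ ∈ Γ, ∃ x ∈ X, φ x - x = z}

namespace AddSubgroup

section opCommutator

open scoped addCommutatorElement

variable {G : Type*} [AddGroup G] {Γ : Set (G →+ G)}

theorem sub_mem_opCommutator {X : AddSubgroup G} {φ : G →+ G} (hφ : φ ∈ Γ) {x : G} (hx : x ∈ X) :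
    φ x - x ∈ opCommutator Γ X :=
  subset_closure ⟨φ, hφ, x, hx, rfl⟩

theorem opCommutator_mono {X Y : AddSubgroup G} (h : X ≤ Y) :
    opCommutator Γ X ≤ opCommutator Γ Y :=
  closure_mono fun _ ⟨φ, hφ, x, hx, hz⟩ => ⟨φ, hφ, x, h hx, hz⟩

/-- For normal `N`, the elements `x` such that `φ x ≡ x` modulo `N` for all `φ ∈ Γ`. -/
def opCentral (Γ : Set (G →+ G)) (N : AddSubgroup G) [hN : N.Normal] : AddSubgroup G where
  carrier := {x | ∀ φ ∈ Γ, φ x - x ∈ N}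
  zero_mem' φ _ := by simp
  add_mem' {x y} hx hy φ hφ := by
    have h := N.add_mem (hx φ hφ) (hN.conj_mem _ (hy φ hφ) x)
    have e : φ (x + y) - (x + y) = φ x - x + (x + (φ y - y) + -x) := by
      simp only [map_add, sub_eq_add_neg, neg_add_rev, add_assoc, neg_add_cancel_left]
    rw [e]; exact h
  neg_mem' {x} hx φ hφ := by
    have h := hN.conj_mem _ (N.neg_mem (hx φ hφ)) (-x)
    have e : φ (-x) - (-x) = -x + -(φ x - x) + - -x := by
      simp only [map_neg, sub_eq_add_neg, neg_add_rev, neg_add_cancel_left, neg_neg]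
    rw [e]; exact h

theorem opCommutator_le_iff {X N : AddSubgroup G} [N.Normal] :
    opCommutator Γ X ≤ N ↔ X ≤ opCentral Γ N := by
  rw [opCommutator, closure_le]
  constructor
  · intro h x hx φ hφ
    exact h ⟨φ, hφ, x, hx, rfl⟩
  · rintro h _ ⟨φ, hφ, x, hx, rfl⟩
    exact h hx φ hφ

theorem apply_mem_of_opCommutator_le {X : AddSubgroup G} (hX : opCommutator Γ X ≤ X)
    {φ : G →+ G} (hφ : φ ∈ Γ) {x : G} (hx : x ∈ X) : φ x ∈ X := by
  have := X.add_mem (hX (sub_mem_opCommutator hφ hx)) hx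
  rwa [sub_add_cancel] at this

theorem opCommutator_le_of_apply_mem {X : AddSubgroup G} (hX : ∀ φ ∈ Γ, ∀ x ∈ X, φ x ∈ X) :
    opCommutator Γ X ≤ X := by
  rw [opCommutator, closure_le]
  rintro _ ⟨φ, hφ, x, hx, rfl⟩
  exact X.sub_mem (hX φ hφ x hx) hx

theorem iterate_opCommutator_mono {X Y : AddSubgroup G} (h : X ≤ Y) (n : ℕ) :
    (opCommutator Γ)^[n] X ≤ (opCommutator Γ)^[n] Y :=
  Monotone.iterate (fun _ _ h => opCommutator_mono h) n h

theorem opCommutator_iterate_le {X : AddSubgroup G} (hX : opCommutator Γ X ≤ X) (n : ℕ) :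
    opCommutator Γ ((opCommutator Γ)^[n] X) ≤ (opCommutator Γ)^[n] X := by
  rw [← Function.iterate_succ_apply' (opCommutator Γ), Function.iterate_succ_apply]
  exact iterate_opCommutator_mono hX n

theorem iterate_opCommutator_antitone {X : AddSubgroup G} (hX : opCommutator Γ X ≤ X) :
    Antitone fun n => (opCommutator Γ)^[n] X :=
  antitone_nat_of_succ_le fun n => by
    rw [Function.iterate_succ_apply']
    exact opCommutator_iterate_le hX n

theorem normal_of_opCommutator_le (hΓ : ∀ g : G, ∀ x, ∃ φ ∈ Γ, φ x = g + x + -g)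
    {X : AddSubgroup G} (hX : opCommutator Γ X ≤ X) : X.Normal :=
  by
  refine ⟨fun x hx g => ?_⟩
  obtain ⟨φ, hφ, h⟩ := hΓ g x
  exact h ▸ apply_mem_of_opCommutator_le hX hφ hx

/-- A product rule for `opCommutator` on commutators. -/
theorem opCommutator_commutator_le (hΓ : ∀ g : G, ∀ x, ∃ φ ∈ Γ, φ x = g + x + -g)
    {X Y N : AddSubgroup G} [N.Normal] (hX : opCommutator Γ X ≤ X) (hY : opCommutator Γ Y ≤ Y)
    (h₁ : ⁅opCommutator Γ X, Y⁆ ≤ N) (h₂ : ⁅X, opCommutator Γ Y⁆ ≤ N) :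
    opCommutator Γ ⁅X, Y⁆ ≤ N := by
  have nX := normal_of_opCommutator_le hΓ hX
  have nY := normal_of_opCommutator_le hΓ hY
  rw [opCommutator_le_iff, addCommutator_le]
  intro x hx y hy φ hφ
  have key : ∀ z w : G, ⁅z, w⁆ ∈ N →
      AddCommute (QuotientAddGroup.mk z : G ⧸ N) (QuotientAddGroup.mk w) := by
    intro z w h
    rw [← addCommutatorElement_eq_zero_iff_addCommute]
    exact (QuotientAddGroup.eq_zero_iff _).2 h
  obtain ⟨x', hx', ex⟩ : ∃ x' ∈ opCommutator Γ X, φ x = x' + x :=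
    ⟨φ x - x, sub_mem_opCommutator hφ hx, by simp⟩
  obtain ⟨y', hy', ey⟩ : ∃ y' ∈ opCommutator Γ Y, φ y = y' + y :=
    ⟨φ y - y, sub_mem_opCommutator hφ hy, by simp⟩
  have hφy : φ y ∈ Y := apply_mem_of_opCommutator_le hY hφ hy
  have c₁ := key x' ⁅x, φ y⁆
    (h₁ (addCommutator_mem_addCommutator hx'
      (addCommutator_le_right X Y (addCommutator_mem_addCommutator hx hφy))))
  have c₂ := key x y' (h₂ (addCommutator_mem_addCommutator hx hy'))
  have c₃ := key ⁅x, y⁆ y' (h₂ (addCommutator_mem_addCommutator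
    (addCommutator_le_left X Y (addCommutator_mem_addCommutator hx hy)) hy'))
  rw [← QuotientAddGroup.eq_zero_iff, QuotientAddGroup.mk_sub, sub_eq_zero, map_addCommutatorElement]
  have e₁ : ((⁅φ x, φ y⁆ : G) : G ⧸ N) = (⁅x, φ y⁆ : G) := by
    have : ⁅φ x, φ y⁆ = x' + ⁅x, φ y⁆ - x' + ⁅x', φ y⁆ := by
      rw [ex]; simp [addCommutatorElement_def, sub_eq_add_neg, add_assoc]
    have h0 : ((⁅x', φ y⁆ : G) : G ⧸ N) = 0 :=
      (QuotientAddGroup.eq_zero_iff _).2 (h₁ (addCommutator_mem_addCommutator hx' hφy))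
    rw [this, QuotientAddGroup.mk_add, h0, QuotientAddGroup.mk_sub, QuotientAddGroup.mk_add,
      c₁.eq, add_sub_cancel_right, add_zero]
  have e₂ : ((⁅x, φ y⁆ : G) : G ⧸ N) = (⁅x, y⁆ : G) := by
    have : ⁅x, φ y⁆ = ⁅x, y'⁆ + (y' + ⁅x, y⁆ - y') := by
      rw [ey]; simp [addCommutatorElement_def, sub_eq_add_neg, add_assoc]
    have h0 : ((⁅x, y'⁆ : G) : G ⧸ N) = 0 :=
      (QuotientAddGroup.eq_zero_iff _).2 (h₂ (addCommutator_mem_addCommutator hx hy'))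
    rw [this, QuotientAddGroup.mk_add, h0, QuotientAddGroup.mk_sub, QuotientAddGroup.mk_add,
      ← c₃.eq, add_sub_cancel_right, zero_add]
  rw [e₁, e₂]

theorem iterate_opCommutator_commutator_le
    (hΓ : ∀ g : G, ∀ x, ∃ φ ∈ Γ, φ x = g + x + -g)
    {X Y : AddSubgroup G} (hX : opCommutator Γ X ≤ X) (hY : opCommutator Γ Y ≤ Y) (n : ℕ) :
    (opCommutator Γ)^[n] ⁅X, Y⁆ ≤
      ⨆ p : {p : ℕ × ℕ // p.1 + p.2 = n},
        ⁅(opCommutator Γ)^[p.1.1] X, (opCommutator Γ)^[p.1.2] Y⁆ := by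
  have nX i := normal_of_opCommutator_le hΓ (opCommutator_iterate_le hX i)
  have nY i := normal_of_opCommutator_le hΓ (opCommutator_iterate_le hY i)
  induction n with
  | zero => exact le_iSup_of_le (⟨(0, 0), rfl⟩ : {p : ℕ × ℕ // p.1 + p.2 = 0}) le_rfl
  | succ n ih =>
    rw [Function.iterate_succ_apply']
    refine (opCommutator_mono ih).trans ?_
    set S := ⨆ p : {p : ℕ × ℕ // p.1 + p.2 = n + 1},
        ⁅(opCommutator Γ)^[p.1.1] X, (opCommutator Γ)^[p.1.2] Y⁆
    have nS : S.Normal := by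
      have := fun p : {p : ℕ × ℕ // p.1 + p.2 = n + 1} =>
        @addCommutator_normal G _ _ _ (nX p.1.1) (nY p.1.2)
      exact AddSubgroup.iSup_normal _
    rw [opCommutator_le_iff]
    refine iSup_le fun ⟨⟨i, j⟩, hij⟩ => ?_
    rw [← opCommutator_le_iff]
    refine opCommutator_commutator_le hΓ (opCommutator_iterate_le hX i)
      (opCommutator_iterate_le hY j) ?_ ?_
    · rw [← Function.iterate_succ_apply' (opCommutator Γ)]
      exact le_iSup_of_le (⟨(i + 1, j), by simp at hij ⊢; omega⟩ :
        {p : ℕ × ℕ // p.1 + p.2 = n + 1}) le_rfl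
    · rw [← Function.iterate_succ_apply' (opCommutator Γ)]
      exact le_iSup_of_le (⟨(i, j + 1), by simp at hij ⊢; omega⟩ :
        {p : ℕ × ℕ // p.1 + p.2 = n + 1}) le_rfl

theorem apply_mem_lowerCentralSeries (φ : G →+ G) (k : ℕ) :
    ∀ x ∈ (⊤ : AddSubgroup G).lowerCentralSeries k,
      φ x ∈ (⊤ : AddSubgroup G).lowerCentralSeries k := by
  induction k with
  | zero => intro x _; trivial
  | succ k ih =>
    suffices h : ⁅(⊤ : AddSubgroup G).lowerCentralSeries k, ⊤⁆ ≤
        ((⊤ : AddSubgroup G).lowerCentralSeries (k + 1)).comap φ from fun x hx => h hx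
    rw [addCommutator_le]
    intro x hx y _
    rw [mem_comap, map_addCommutatorElement]
    exact addCommutator_mem_addCommutator (ih x hx) (mem_top _)

theorem commutator_lowerCentralSeries_commutator_le (k : ℕ) :
    ⁅(⊤ : AddSubgroup G).lowerCentralSeries k, ⁅(⊤ : AddSubgroup G), (⊤ : AddSubgroup G)⁆⁆ ≤
      (⊤ : AddSubgroup G).lowerCentralSeries (k + 2) := by
  set L := (⊤ : AddSubgroup G).lowerCentralSeries
  let f := QuotientAddGroup.mk' (L (k + 2))
  have h : (⁅⁅L k, (⊤ : AddSubgroup G)⁆, (⊤ : AddSubgroup G)⁆).map f = ⊥ := by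
    rw [AddSubgroup.map_eq_bot_iff, QuotientAddGroup.ker_mk']
    exact le_rfl
  have h' : (⁅⁅(⊤ : AddSubgroup G), L k⁆, (⊤ : AddSubgroup G)⁆).map f = ⊥ := by
    rwa [addCommutator_comm (⊤ : AddSubgroup G) (L k)]
  rw [addCommutator_comm, ← QuotientAddGroup.ker_mk' (L (k + 2)), ← AddSubgroup.map_eq_bot_iff]
  rw [map_addCommutator, map_addCommutator] at h h' ⊢
  exact addCommutator_addCommutator_eq_bot_of_rotate h' h

/-- An analogue of a theorem of P. Hall: if `Γ` acts nilpotently on the abelianization of a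
nilpotent group, then it acts nilpotently on the group. -/
theorem exists_iterate_opCommutator_eq_bot
    (hΓ : ∀ g : G, ∀ x, ∃ φ ∈ Γ, φ x = g + x + -g) (hG : AddGroup.IsNilpotent G)
    {N : ℕ} (hN : (opCommutator Γ)^[N] ⊤ ≤ ⁅(⊤ : AddSubgroup G), (⊤ : AddSubgroup G)⁆) :
    ∃ M, (opCommutator Γ)^[M] (⊤ : AddSubgroup G) = ⊥ := by
  set L := (⊤ : AddSubgroup G).lowerCentralSeries
  have hL k : opCommutator Γ (L k) ≤ L k :=
    opCommutator_le_of_apply_mem fun φ _ => apply_mem_lowerCentralSeries φ k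
  have hT : opCommutator Γ (⊤ : AddSubgroup G) ≤ ⊤ := le_top
  have step : ∀ k, ∃ m, (opCommutator Γ)^[m] (L k) ≤ L (k + 1) := by
    intro k
    induction k with
    | zero => exact ⟨N, hN⟩
    | succ k ih =>
      obtain ⟨m, hm⟩ := ih
      refine ⟨m + N, (iterate_opCommutator_commutator_le hΓ (hL k) hT (m + N)).trans ?_⟩
      refine iSup_le fun ⟨⟨i, j⟩, hij⟩ => ?_
      by_cases hi : m ≤ i
      · exact addCommutator_mono ((iterate_opCommutator_antitone (hL k) hi).trans hm) le_top
      · have hj : N ≤ j := by simp at hij; omega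
        refine (addCommutator_mono ?_ ((iterate_opCommutator_antitone hT hj).trans hN)).trans
          (commutator_lowerCentralSeries_commutator_le k)
        exact iterate_opCommutator_antitone (hL k) (Nat.zero_le i)
  have reach : ∀ k, ∃ M, (opCommutator Γ)^[M] ⊤ ≤ L k := by
    intro k
    induction k with
    | zero => exact ⟨0, le_rfl⟩
    | succ k ih =>
      obtain ⟨M, hM⟩ := ih
      obtain ⟨m, hm⟩ := step k
      refine ⟨m + M, ?_⟩
      rw [Function.iterate_add_apply]
      exact (iterate_opCommutator_mono hM m).trans hm
  obtain ⟨n, hn⟩ := AddSubgroup.nilpotent_iff_lowerCentralSeries.1 hG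
  obtain ⟨M, hM⟩ := reach n
  exact ⟨M, le_bot_iff.1 (hM.trans hn.le)⟩

end opCommutator

end AddSubgroup

theorem Int.isJacobsonRing : IsJacobsonRing ℤ := by
  rw [isJacobsonRing_iff_prime_eq]
  intro P hP
  by_cases h : P = ⊥
  · subst h
    rw [eq_bot_iff]
    intro x hx
    rw [Ideal.mem_jacobson_bot] at hx
    by_contra h0
    have h1 := Int.isUnit_iff.1 (hx x)
    have h2 := Int.isUnit_iff.1 (hx (-x))
    have h3 : 0 < x * x := mul_self_pos.2 h0
    have h4 : x * -x = -(x * x) := by ring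
    have h5 := Int.isUnit_iff.1 (hx (2 * x))
    have h6 : x * (2 * x) = 2 * (x * x) := by ring
    omega
  · have := hP.isMaximal h
    exact Ideal.jacobson_eq_self_of_isMaximal

/-- In a commutative ring of finite type over `ℤ`, an element all of whose multiples are
quasi-regular is nilpotent. -/
theorem isNilpotent_of_forall_isUnit_mul_add_one {C : Type*} [CommRing C]
    [Algebra.FiniteType ℤ C] {x : C} (hx : ∀ y, IsUnit (x * y + 1)) : IsNilpotent x := by
  have := Int.isJacobsonRing
  have : IsJacobsonRing C := isJacobsonRing_of_finiteType (A := ℤ)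
  rw [← mem_nilradical, nilradical, Ideal.radical_eq_jacobson]
  exact Ideal.mem_jacobson_bot.2 hx

/-- In a nil ideal `J`, if the left annihilator of `a ∈ J` modulo `N` is maximal among those of
elements outside `N`, then `a E a ⊆ N`. -/
theorem mul_mul_mem_of_maximal_annihilator {E : Type*} [Ring E]
    {J N : Ideal E} [J.IsTwoSided] [N.IsTwoSided]
    (hnil : ∀ x ∈ J, IsNilpotent x) {a : E} (haJ : a ∈ J) (haN : a ∉ N)
    (hmax : ∀ b ∈ J, b ∉ N → (∀ x ∈ J, x * a ∈ N → x * b ∈ N) → ∀ x ∈ J, x * b ∈ N → x * a ∈ N)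
    (x : E) : a * x * a ∈ N := by
  classical
  obtain ⟨n, hn⟩ := hnil (x * a) (J.mul_mem_left x haJ)
  have hex : ∃ k, a * (x * a) ^ k ∈ N := ⟨n, by simp [hn]⟩
  obtain ⟨k, hk, hmin⟩ : ∃ k, a * (x * a) ^ k ∈ N ∧ ∀ j < k, a * (x * a) ^ j ∉ N :=
    ⟨Nat.find hex, Nat.find_spec hex, fun j hj => Nat.find_min hex hj⟩
  obtain _ | k := k
  · simp at hk; exact absurd hk haN
  have hb := hmin k (Nat.lt_succ_self k)
  have := hmax (a * (x * a) ^ k) (Ideal.mul_mem_right _ _ haJ) hb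
    (fun y _ hy => by rw [← mul_assoc]; exact Ideal.mul_mem_right _ _ hy)
    (a * x) (Ideal.mul_mem_right _ _ haJ) (by
      have e : a * x * (a * (x * a) ^ k) = a * (x * a) ^ (k + 1) := by
        rw [pow_succ']; simp only [mul_assoc]
      rwa [e])
  exact this

/-- **Levitzki's theorem**: a nil ideal satisfying the maximum condition on left ideals is
nilpotent. -/
theorem Ideal.isNilpotent_of_forall_isNilpotent {E : Type*} [Ring E] (J : Ideal E) [J.IsTwoSided]
    [WellFoundedGT (Set.Iic J)] (hnil : ∀ x ∈ J, IsNilpotent x) : ∃ n, J ^ n = ⊥ := by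
  have hwf : WellFoundedGT (Set.Iic J) := inferInstance
  obtain ⟨⟨N, hNJ⟩, ⟨hN2, n, hn⟩, hNmax⟩ := hwf.wf.has_min
    {I : Set.Iic J | I.1.IsTwoSided ∧ ∃ n, I.1 ^ n = ⊥}
    ⟨⟨⊥, bot_le (a := J)⟩, inferInstance, 1, by rw [Submodule.pow_one]⟩
  replace hN2 : N.IsTwoSided := hN2
  replace hNJ : N ≤ J := hNJ
  by_cases hJN : J ≤ N
  · exact ⟨n, by rwa [le_antisymm hJN hNJ]⟩
  exfalso
  let ann : E → Set.Iic J := fun b =>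
    ⟨{ carrier := {x | x ∈ J ∧ x * b ∈ N}
       zero_mem' := by simp
       add_mem' := fun {x y} hx hy => ⟨J.add_mem hx.1 hy.1, by
        rw [add_mul]; exact N.add_mem hx.2 hy.2⟩
       smul_mem' := fun c x hx => ⟨J.mul_mem_left c hx.1, by
        rw [smul_eq_mul, mul_assoc]; exact N.mul_mem_left c hx.2⟩ }, fun _ hx => hx.1⟩
  obtain ⟨a₀, ha₀⟩ := Set.not_subset.1 hJN
  obtain ⟨_, ⟨a, ⟨haJ, haN⟩, rfl⟩, hamax⟩ := hwf.wf.has_min (ann '' {b | b ∈ J ∧ b ∉ N})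
    ⟨_, a₀, ha₀, rfl⟩
  have haa : ∀ x, a * x * a ∈ N := by
    refine mul_mul_mem_of_maximal_annihilator hnil haJ haN fun b hbJ hbN hab x hxJ hxb => ?_
    by_contra hxa
    refine hamax (ann b) ⟨b, ⟨hbJ, hbN⟩, rfl⟩ ?_
    refine lt_of_le_not_ge (fun y hy => ⟨hy.1, hab y hy.1 hy.2⟩) fun hle => hxa ?_
    exact (hle (show x ∈ (ann b).1 from ⟨hxJ, hxb⟩)).2
  let K : Ideal E := Ideal.span (Set.range fun e => a * e)
  have haK : ∀ e, a * e ∈ K := fun e => Ideal.subset_span ⟨e, rfl⟩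
  have hK2 : K.IsTwoSided := ⟨fun {x} b hx => by
    induction hx using Submodule.span_induction with
    | mem x h =>
      obtain ⟨e, rfl⟩ := h
      simpa only [mul_assoc] using haK (e * b)
    | zero => simp
    | add x y _ _ hx hy => rw [add_mul]; exact K.add_mem hx hy
    | smul c x _ hx => rw [smul_eq_mul, mul_assoc]; exact K.mul_mem_left c hx⟩
  have hKJ : K ≤ J := Ideal.span_le.2 (by
    rintro _ ⟨e, rfl⟩
    exact Ideal.mul_mem_right _ _ haJ)
  have hKK : K * K ≤ N := by
    have h₁ : ∀ s ∈ K, ∀ e, a * e * s ∈ N := by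
      intro s hs
      induction hs using Submodule.span_induction with
      | mem x h =>
        obtain ⟨f, rfl⟩ := h
        intro e
        rw [← mul_assoc]
        exact Ideal.mul_mem_right _ _ (haa e)
      | zero => simp
      | add x y _ _ hx hy => intro e; rw [mul_add]; exact N.add_mem (hx e) (hy e)
      | smul c x _ hx =>
        intro e
        rw [smul_eq_mul, ← mul_assoc, mul_assoc a]
        exact hx _
    rw [Ideal.mul_le]
    intro r hr s hs
    induction hr using Submodule.span_induction with
    | mem x h => obtain ⟨e, rfl⟩ := h; exact h₁ s hs e
    | zero => simp
    | add x y _ _ hx hy => rw [add_mul]; exact N.add_mem hx hy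
    | smul c x _ hx => rw [smul_eq_mul, mul_assoc]; exact N.mul_mem_left c hx
  have hII : (N ⊔ K) * (N ⊔ K) ≤ N := by
    rw [Ideal.mul_le]
    intro r hr s hs
    obtain ⟨x, hx, y, hy, rfl⟩ := Submodule.mem_sup.1 hr
    obtain ⟨z, hz, w, hw, rfl⟩ := Submodule.mem_sup.1 hs
    rw [add_mul, mul_add y]
    exact N.add_mem (Ideal.mul_mem_right _ _ hx)
      (N.add_mem (N.mul_mem_left y hz) (hKK (Ideal.mul_mem_mul hy hw)))
  have hNK : (N ⊔ K).IsTwoSided := ⟨fun {x} b hx => by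
    obtain ⟨y, hy, z, hz, rfl⟩ := Submodule.mem_sup.1 hx
    rw [add_mul]
    exact Submodule.add_mem_sup (Ideal.mul_mem_right _ _ hy) (Ideal.mul_mem_right _ _ hz)⟩
  have hpow : ∀ m, (N ⊔ K) ^ (2 * m) ≤ N ^ m := by
    intro m
    induction m with
    | zero => rw [mul_zero, Submodule.pow_zero, Submodule.pow_zero]
    | succ m ih =>
      rw [show 2 * (m + 1) = 2 * m + 1 + 1 by ring, Ideal.IsTwoSided.pow_succ,
        Ideal.IsTwoSided.pow_succ, ← mul_assoc, Ideal.IsTwoSided.pow_succ]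
      exact Ideal.mul_mono hII ih
  refine hNmax ⟨N ⊔ K, sup_le hNJ hKJ⟩ ⟨hNK, 2 * n, ?_⟩ ?_
  · exact le_bot_iff.1 ((hpow n).trans hn.le)
  · refine lt_of_le_not_ge (le_sup_left : N ≤ N ⊔ K) fun h : N ⊔ K ≤ N => haN (h ?_)
    exact Ideal.mem_sup_right (by simpa using haK 1)

/-- If the subgroups of a group satisfy the maximum condition, then they are finitely generated. -/
@[to_additive /-- If the subgroups of an additive group satisfy the maximum condition, then they are
finitely generated. -/]
theorem Subgroup.exists_finset_closure_eq {G : Type*} [Group G] [h : WellFoundedGT (Subgroup G)]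
    (D : Subgroup G) : ∃ s : Finset G, closure (s : Set G) = D := by
  classical
  obtain ⟨_, ⟨s, hs, rfl⟩, hmax⟩ := h.wf.has_min
    {H | ∃ s : Finset G, closure (s : Set G) ≤ D ∧ closure (s : Set G) = H}
    ⟨_, ∅, by simp, rfl⟩
  refine ⟨s, le_antisymm hs fun x hx => ?_⟩
  by_contra hxs
  refine hmax _ ⟨insert x s, ?_, rfl⟩ ?_
  · rw [closure_le] at hs ⊢
    rw [Finset.coe_insert]
    exact Set.insert_subset hx hs
  · refine lt_of_le_not_ge (closure_mono (by simp)) fun hle => hxs (hle ?_)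
    exact subset_closure (by simp)

namespace SkewBrace

theorem one_eq_zero {A : Type*} [SkewBrace A] : (1 : A) = 0 := by
  have h := mul_add_eq (1 : A) 0 0
  simp only [one_mul, add_zero, zero_sub] at h
  exact (neg_eq_zero.1 h.symm)

section Radical

variable {A E : Type*} [SkewBrace A] [Ring E] (j : A →+ E)

/-- An additive map `j` from a skew brace to a ring turning `∘` into the circle operation
`x + y + x * y` induces the homomorphism `a ↦ 1 + j a` from `(A, ∘)`. -/
def oneAddHom (hj : ∀ a b, j (a * b) = j a + j b + j a * j b) : A →* E where
  toFun a := 1 + j a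
  map_one' := by rw [one_eq_zero, map_zero, add_zero]
  map_mul' a b := by
    rw [hj]
    noncomm_ring

theorem exists_finset_adjoin (hj : ∀ a b, j (a * b) = j a + j b + j a * j b)
    (hmax : WellFoundedGT (AddSubgroup A) ∨ WellFoundedGT (Subgroup A)) (C : Subring E)
    (hC : ∀ b, oneAddHom j hj b ∈ C → oneAddHom j hj b⁻¹ ∈ C) :
    ∃ s : Finset A, (∀ b ∈ s, oneAddHom j hj b ∈ C) ∧ ∀ b, oneAddHom j hj b ∈ C →
      oneAddHom j hj b ∈ Algebra.adjoin ℤ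
        ((oneAddHom j hj) '' s ∪ (fun b => oneAddHom j hj b⁻¹) '' s) := by
  set u := oneAddHom j hj
  have hu : ∀ b, u b = 1 + j b := fun _ => rfl
  have hadd : ∀ a b, u (a + b) = u a + u b - 1 := fun a b => by
    simp only [hu, map_add]; abel
  have hneg : ∀ a, u (-a) = 1 + 1 - u a := fun a => by
    simp only [hu, map_neg]; abel
  have hzero : u 0 = 1 := by rw [← one_eq_zero, map_one]
  clear_value u
  rcases hmax with hmax | hmax
  · let D : AddSubgroup A :=
      { carrier := {b | u b ∈ C}
        zero_mem' := by
          show u 0 ∈ C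
          rw [hzero]; exact C.one_mem
        add_mem' := fun {a b} ha hb => by
          show u (a + b) ∈ C
          rw [hadd]; exact C.sub_mem (C.add_mem ha hb) C.one_mem
        neg_mem' := fun {a} ha => by
          show u (-a) ∈ C
          rw [hneg]; exact C.sub_mem (C.add_mem C.one_mem C.one_mem) ha }
    obtain ⟨s, hs⟩ := AddSubgroup.exists_finset_closure_eq D
    refine ⟨s, fun b hb => (hs ▸ AddSubgroup.subset_closure hb : b ∈ D), fun b hb => ?_⟩
    have hb' : b ∈ AddSubgroup.closure (s : Set A) := hs ▸ hb
    clear hb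
    set S := Algebra.adjoin ℤ (u '' s ∪ (fun b => u b⁻¹) '' s)
    induction hb' using AddSubgroup.closure_induction with
    | mem x hx => exact Algebra.subset_adjoin (Or.inl ⟨x, hx, rfl⟩)
    | zero => rw [hzero]; exact S.one_mem
    | add a b _ _ ha hb => rw [hadd]; exact S.sub_mem (S.add_mem ha hb) S.one_mem
    | neg a _ ha => rw [hneg]; exact S.sub_mem (S.add_mem S.one_mem S.one_mem) ha
  · let D : Subgroup A :=
      { carrier := {b | u b ∈ C}
        one_mem' := by
          show u 1 ∈ C
          rw [map_one]; exact C.one_mem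
        mul_mem' := fun {a b} ha hb => by
          show u (a * b) ∈ C
          rw [map_mul]; exact C.mul_mem ha hb
        inv_mem' := fun {a} ha => hC a ha }
    obtain ⟨s, hs⟩ := Subgroup.exists_finset_closure_eq D
    refine ⟨s, fun b hb => (hs ▸ Subgroup.subset_closure hb : b ∈ D), fun b hb => ?_⟩
    have hb' : b ∈ Subgroup.closure (s : Set A) := hs ▸ hb
    clear hb
    set S := Algebra.adjoin ℤ (u '' s ∪ (fun b => u b⁻¹) '' s)
    suffices h : u b ∈ S ∧ u b⁻¹ ∈ S from h.1
    induction hb' using Subgroup.closure_induction with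
    | mem x hx =>
      exact ⟨Algebra.subset_adjoin (Or.inl ⟨x, hx, rfl⟩),
        Algebra.subset_adjoin (Or.inr ⟨x, hx, rfl⟩)⟩
    | one => rw [inv_one, map_one]; exact ⟨S.one_mem, S.one_mem⟩
    | mul a b _ _ ha hb =>
      rw [mul_inv_rev, map_mul, map_mul]
      exact ⟨S.mul_mem ha.1 hb.1, S.mul_mem hb.2 ha.2⟩
    | inv a _ ha => rw [inv_inv]; exact ha.symm

theorem oneAddHom_inv_mem_centralizer (hj : ∀ a b, j (a * b) = j a + j b + j a * j b)
    (X : Set (E)) (b : A) (hb : oneAddHom j hj b ∈ Subring.centralizer X) :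
    oneAddHom j hj b⁻¹ ∈ Subring.centralizer X := by
  rw [Subring.mem_centralizer_iff] at hb ⊢
  intro g hg
  have h := hb g hg
  have h₁ : oneAddHom j hj b * oneAddHom j hj b⁻¹ = 1 := by
    rw [← map_mul, mul_inv_cancel, map_one]
  have h₂ : oneAddHom j hj b⁻¹ * oneAddHom j hj b = 1 := by
    rw [← map_mul, inv_mul_cancel, map_one]
  generalize oneAddHom j hj b = v at *
  generalize oneAddHom j hj b⁻¹ = w at *
  calc g * w = w * v * g * w := by rw [h₂, one_mul]
    _ = w * g := by rw [mul_assoc w, ← h, mul_assoc, mul_assoc, h₁, mul_one]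

theorem isNilpotent_apply (hj : ∀ a b, j (a * b) = j a + j b + j a * j b)
    (hE : ∀ c : E, ∃ (n : ℤ) (b : A), c = n + j b) (hmul : ∀ a (c : E), ∃ b, j a * c = j b)
    (hmax : WellFoundedGT (AddSubgroup A) ∨ WellFoundedGT (Subgroup A)) (a : A) :
    IsNilpotent (j a) := by
  set u := oneAddHom j hj
  have hu : ∀ b, u b = 1 + j b := fun _ => rfl
  let K := Subring.centralizer ({j a} : Set E)
  let C := Subring.centralizer (K : Set E)
  have hxK : j a ∈ K := fun g hg => by rw [Set.mem_singleton_iff.1 hg]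
  have hxC : j a ∈ C := fun g hg => (hg (j a) rfl).symm
  have hCK : C ≤ K := fun c hc g hg => by
    rw [Set.mem_singleton_iff.1 hg]; exact hc (j a) hxK
  have hinv : ∀ b, u b ∈ C → u b⁻¹ ∈ C := oneAddHom_inv_mem_centralizer j hj _
  let _ : CommRing C :=
    { (inferInstance : Ring C) with
      mul_comm := fun c d => Subtype.ext (d.2 c (hCK c.2)) }
  obtain ⟨s, hsC, hs⟩ := exists_finset_adjoin j hj hmax C hinv
  have hfg : (subalgebraOfSubring C).FG := by
    rw [Subalgebra.fg_def]
    refine ⟨u '' s ∪ (fun b => u b⁻¹) '' s,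
      (s.finite_toSet.image _).union (s.finite_toSet.image _), le_antisymm ?_ ?_⟩
    · rw [Algebra.adjoin_le_iff]
      rintro _ (⟨b, hb, rfl⟩ | ⟨b, hb, rfl⟩)
      · exact hsC b hb
      · exact hinv b (hsC b hb)
    · intro c hc
      obtain ⟨n, b, rfl⟩ := hE c
      set S := Algebra.adjoin ℤ (u '' s ∪ (fun b => u b⁻¹) '' s)
      have e : u b = 1 + ((n + j b) - n) := by rw [hu, add_sub_cancel_left]
      have hbC : u b ∈ C := by
        rw [e]
        exact C.add_mem C.one_mem (C.sub_mem hc (intCast_mem C n))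
      have e' : (n : E) + j b = n + (u b - 1) := by rw [hu, add_sub_cancel_left]
      rw [e']
      exact S.add_mem (intCast_mem S n) (S.sub_mem (hs b hbC) S.one_mem)
  have hft : Algebra.FiniteType ℤ C := (subalgebraOfSubring C).fg_iff_finiteType.1 hfg
  have hnil : IsNilpotent (⟨j a, hxC⟩ : C) := by
    refine isNilpotent_of_forall_isUnit_mul_add_one fun y => ?_
    obtain ⟨b, hb⟩ := hmul a y
    have hub : u b = j a * y + 1 := by rw [hu, hb, add_comm]
    have hbC : u b ∈ C := by
      rw [hub]; exact C.add_mem (C.mul_mem hxC y.2) C.one_mem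
    refine IsUnit.of_mul_eq_one ⟨u b⁻¹, hinv b hbC⟩ (Subtype.ext ?_)
    show (j a * y + 1) * u b⁻¹ = 1
    rw [← hub, ← map_mul, mul_inv_cancel, map_one]
  obtain ⟨n, hn⟩ := hnil
  exact ⟨n, congrArg Subtype.val hn⟩

theorem wellFoundedGT_Iic_of_range_eq (hj : ∀ a b, j (a * b) = j a + j b + j a * j b)
    (hmax : WellFoundedGT (AddSubgroup A) ∨ WellFoundedGT (Subgroup A))
    {J : Ideal E} (hJ : ∀ x ∈ J, ∃ b, j b = x) : WellFoundedGT (Set.Iic J) := by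
  have hle : ∀ I I' : Set.Iic J, (∀ b, j b ∈ I'.1 → j b ∈ I.1) → I' ≤ I := by
    intro I I' h x hx
    obtain ⟨b, rfl⟩ := hJ x (I'.2 hx)
    exact h b hx
  rcases hmax with hmax | hmax
  · let f : Set.Iic J → AddSubgroup A := fun I => I.1.toAddSubgroup.comap j
    have hf : StrictMono f := fun I I' h =>
      lt_of_le_not_ge (fun b hb => h.le hb) fun h' => h.not_ge (hle I I' fun b hb => h' hb)
    exact hf.wellFoundedGT
  · let f : Set.Iic J → Subgroup A := fun I =>
      { carrier := {b | j b ∈ I.1}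
        one_mem' := by
          show j 1 ∈ I.1
          rw [one_eq_zero, map_zero]; exact I.1.zero_mem
        mul_mem' := fun {a b} ha hb => by
          show j (a * b) ∈ I.1
          rw [hj]
          exact I.1.add_mem (I.1.add_mem ha hb) (I.1.mul_mem_left _ hb)
        inv_mem' := fun {a} ha => by
          show j a⁻¹ ∈ I.1
          have h := hj a⁻¹ a
          rw [inv_mul_cancel, one_eq_zero, map_zero] at h
          have e : j a⁻¹ = -(j a + j a⁻¹ * j a) := by
            rw [eq_neg_iff_add_eq_zero, ← add_assoc, ← h]
          rw [e]
          exact I.1.neg_mem_iff.2 (I.1.add_mem ha (I.1.mul_mem_left _ ha)) }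
    have hf : StrictMono f := fun I I' h =>
      lt_of_le_not_ge (fun b hb => h.le hb) fun h' => h.not_ge (hle I I' fun b hb => h' hb)
    exact hf.wellFoundedGT

/-- A radical ring whose additive group or adjoint group satisfies the maximum condition is
nilpotent; here the ring is an ideal `J` in a ring `E = ℤ + J`. -/
theorem exists_pow_eq_bot (hj : ∀ a b, j (a * b) = j a + j b + j a * j b)
    (hmax : WellFoundedGT (AddSubgroup A) ∨ WellFoundedGT (Subgroup A))
    {J : Ideal E} [J.IsTwoSided] (hJ : ∀ x, x ∈ J ↔ ∃ b, j b = x)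
    (hE : ∀ c : E, ∃ (n : ℤ) (b : A), c = n + j b) : ∃ n, J ^ n = ⊥ := by
  have := wellFoundedGT_Iic_of_range_eq j hj hmax fun x => (hJ x).1
  refine Ideal.isNilpotent_of_forall_isNilpotent J fun x hx => ?_
  obtain ⟨b, rfl⟩ := (hJ x).1 hx
  refine isNilpotent_apply j hj hE (fun a c => ?_) hmax b
  obtain ⟨b, hb⟩ := (hJ (j a * c)).1 (J.mul_mem_right c ((hJ _).2 ⟨a, rfl⟩))
  exact ⟨b, hb.symm⟩

end Radical

end SkewBrace

namespace SkewBrace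

section AbelianQuotient

variable (A : Type*) [SkewBrace A]

/-- The abelianization of `(A, +)`. -/
def AbelianQuotient : Type _ := A ⧸ (⁅(⊤ : AddSubgroup A), (⊤ : AddSubgroup A)⁆)

namespace AbelianQuotient

variable {A}

open scoped addCommutatorElement in
instance : AddCommGroup (AbelianQuotient A) :=
  { (inferInstance : AddGroup (A ⧸ (⁅(⊤ : AddSubgroup A), (⊤ : AddSubgroup A)⁆))) with
    add_comm := by
      rintro ⟨a⟩ ⟨b⟩
      refine (addCommutatorElement_eq_zero_iff_addCommute
        (G := A ⧸ (⁅(⊤ : AddSubgroup A), (⊤ : AddSubgroup A)⁆))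
        (g₁ := QuotientAddGroup.mk a) (g₂ := QuotientAddGroup.mk b)).1 ?_
      exact (QuotientAddGroup.eq_zero_iff (⁅a, b⁆ : A)).2
        (AddSubgroup.addCommutator_mem_addCommutator trivial trivial) }

/-- The projection to the abelianization. -/
def proj : A →+ AbelianQuotient A :=
  QuotientAddGroup.mk' (⁅(⊤ : AddSubgroup A), (⊤ : AddSubgroup A)⁆)

theorem proj_surjective : Function.Surjective (proj : A → AbelianQuotient A) :=
  QuotientAddGroup.mk'_surjective _

theorem proj_eq_zero {a : A} : proj a = 0 ↔ a ∈ ⁅(⊤ : AddSubgroup A), (⊤ : AddSubgroup A)⁆ :=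
  QuotientAddGroup.eq_zero_iff a

open scoped addCommutatorElement in
/-- An additive map to a commutative group factors through the abelianization. -/
def lift {W : Type*} [AddCommGroup W] (f : A →+ W) : AbelianQuotient A →+ W :=
  QuotientAddGroup.lift _ f (by
    suffices h : ⁅(⊤ : AddSubgroup A), (⊤ : AddSubgroup A)⁆ ≤ f.ker from fun x hx => h hx
    rw [AddSubgroup.addCommutator_le]
    intro a _ b _
    rw [AddMonoidHom.mem_ker, addCommutatorElement_def]
    simp only [map_add, map_neg]
    abel)

theorem lift_proj {W : Type*} [AddCommGroup W] (f : A →+ W) (a : A) : lift f (proj a) = f a := rfl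

theorem proj_mul_add (a b c : A) : proj (a * (b + c)) = proj (a * b) - proj a + proj (a * c) := by
  rw [mul_add_eq, map_add, map_sub]

theorem proj_add_mul (hA : IsTwoSided A) (a b c : A) :
    proj ((a + b) * c) = proj (a * c) - proj c + proj (b * c) := by
  rw [hA, map_add, map_sub]

/-- The bilinear map induced by `star` on the abelianization. -/
def mulHom (hA : IsTwoSided A) : AbelianQuotient A →+ AbelianQuotient A →+ AbelianQuotient A :=
  lift
    (AddMonoidHom.mk' (fun a => lift
      (AddMonoidHom.mk' (fun b => proj (a * b) - proj a - proj b) fun b c => by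
        rw [proj_mul_add, map_add]; abel)) fun a a' => by
        ext x
        obtain ⟨b, rfl⟩ := proj_surjective x
        simp only [AddMonoidHom.add_apply, lift_proj, AddMonoidHom.mk'_apply]
        rw [proj_add_mul hA, map_add]; abel)

theorem mulHom_proj (hA : IsTwoSided A) (a b : A) :
    mulHom hA (proj a) (proj b) = proj (a * b) - proj a - proj b := rfl

/-- For a two-sided skew brace, the operation `star` makes the abelianization of `(A, +)` a ring. -/
abbrev nonUnitalRing (hA : IsTwoSided A) : NonUnitalRing (AbelianQuotient A) where
  mul x y := mulHom hA x y
  left_distrib x y z := map_add (mulHom hA x) y z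
  right_distrib x y z := by
    show mulHom hA (x + y) z = mulHom hA x z + mulHom hA y z
    rw [map_add, AddMonoidHom.add_apply]
  zero_mul x := by
    show mulHom hA 0 x = 0
    rw [map_zero, AddMonoidHom.zero_apply]
  mul_zero x := map_zero (mulHom hA x)
  mul_assoc x y z := by
    obtain ⟨a, rfl⟩ := proj_surjective x
    obtain ⟨b, rfl⟩ := proj_surjective y
    obtain ⟨c, rfl⟩ := proj_surjective z
    show mulHom hA (mulHom hA (proj a) (proj b)) (proj c) =
      mulHom hA (proj a) (mulHom hA (proj b) (proj c))
    simp only [mulHom_proj, map_sub, AddMonoidHom.sub_apply, mul_assoc]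
    abel

end AbelianQuotient

end AbelianQuotient

section Chain

variable {A : Type*} [SkewBrace A]

variable (A) in
/-- The endomorphisms of `(A, +)` given by left and right multiplications and conjugations. -/
def operators : Set (A →+ A) :=
  {φ | (∃ a, ∀ x, φ x = -a + a * x) ∨ (∃ a, ∀ x, φ x = x * a - a) ∨ ∃ g, ∀ x, φ x = g + x + -g}

theorem exists_operator_left (a : A) : ∃ φ ∈ operators A, ∀ x, φ x = -a + a * x :=
  ⟨AddMonoidHom.mk' (fun x => -a + a * x) fun x y => by
    simp only [mul_add_eq, sub_eq_add_neg, add_assoc], Or.inl ⟨a, fun _ => rfl⟩, fun _ => rfl⟩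

theorem exists_operator_right (hA : IsTwoSided A) (a : A) :
    ∃ φ ∈ operators A, ∀ x, φ x = x * a - a :=
  ⟨AddMonoidHom.mk' (fun x => x * a - a) fun x y => by
    simp only [hA x y a, sub_eq_add_neg, add_assoc], Or.inr (Or.inl ⟨a, fun _ => rfl⟩),
    fun _ => rfl⟩

theorem exists_operator_conj (g : A) : ∃ φ ∈ operators A, ∀ x, φ x = g + x + -g :=
  ⟨AddMonoidHom.mk' (fun x => g + x + -g) fun x y => by
    simp only [add_assoc, neg_add_cancel_left], Or.inr (Or.inr ⟨g, fun _ => rfl⟩), fun _ => rfl⟩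

variable (A) in
/-- The chain of ideals obtained by iterating commutators with `operators A`. -/
def operatorSeries (n : ℕ) : AddSubgroup A :=
  (AddSubgroup.opCommutator (operators A))^[n] ⊤

theorem operatorSeries_succ (n : ℕ) :
    operatorSeries A (n + 1) = AddSubgroup.opCommutator (operators A) (operatorSeries A n) :=
  Function.iterate_succ_apply' _ _ _

theorem sub_mem_operatorSeries {n : ℕ} {φ : A →+ A} (hφ : φ ∈ operators A) {x : A}
    (hx : x ∈ operatorSeries A n) : φ x - x ∈ operatorSeries A (n + 1) := by
  rw [operatorSeries_succ]
  exact AddSubgroup.sub_mem_opCommutator hφ hx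

theorem operator_mem_operatorSeries {n : ℕ} {φ : A →+ A} (hφ : φ ∈ operators A) {x : A}
    (hx : x ∈ operatorSeries A n) : φ x ∈ operatorSeries A n :=
  AddSubgroup.apply_mem_of_opCommutator_le (AddSubgroup.opCommutator_iterate_le le_top n) hφ hx

theorem conj_mem_operatorSeries {n : ℕ} {x : A} (hx : x ∈ operatorSeries A n) (g : A) :
    g + x + -g ∈ operatorSeries A n := by
  obtain ⟨φ, hφ, h⟩ := exists_operator_conj g
  exact h x ▸ operator_mem_operatorSeries hφ hx

theorem commutator_mem_operatorSeries {n : ℕ} {x : A} (hx : x ∈ operatorSeries A n) (g : A) :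
    x + g + -x + -g ∈ operatorSeries A (n + 1) := by
  obtain ⟨φ, hφ, h⟩ := exists_operator_conj g
  have h1 := (operatorSeries A (n + 1)).neg_mem (sub_mem_operatorSeries hφ hx)
  rw [h x] at h1
  simpa only [sub_eq_add_neg, neg_add_rev, neg_neg, add_assoc] using h1

theorem star_left_mem_operatorSeries {n : ℕ} {x : A} (hx : x ∈ operatorSeries A n) (a : A) :
    star a x ∈ operatorSeries A (n + 1) := by
  obtain ⟨φ, hφ, h⟩ := exists_operator_left a
  have h1 := sub_mem_operatorSeries hφ hx
  rwa [h x] at h1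

theorem star_right_mem_operatorSeries (hA : IsTwoSided A) {n : ℕ} {x : A}
    (hx : x ∈ operatorSeries A n) (a : A) : star x a ∈ operatorSeries A (n + 1) := by
  obtain ⟨φ, hφ, h⟩ := exists_operator_right hA a
  have h1 := conj_mem_operatorSeries (sub_mem_operatorSeries hφ hx) (-x)
  rw [h x] at h1
  have e : -x + (x * a - a - x) + - -x = star x a := by
    simp only [star, sub_eq_add_neg, add_assoc, neg_neg, neg_add_cancel, add_zero]
  rwa [e] at h1

/-- The members of the operator series as subgroups of `(A, ∘)`. -/
def operatorSubgroup (n : ℕ) : Subgroup A where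
  carrier := operatorSeries A n
  one_mem' := by
    rw [one_eq_zero]; exact (operatorSeries A n).zero_mem
  mul_mem' {a b} ha hb := by
    obtain ⟨φ, hφ, h⟩ := exists_operator_left a
    have h1 := (operatorSeries A n).add_mem ha (operator_mem_operatorSeries hφ hb)
    rwa [h b, add_neg_cancel_left] at h1
  inv_mem' {a} ha := by
    obtain ⟨φ, hφ, h⟩ := exists_operator_left a⁻¹
    have h1 := (operatorSeries A n).neg_mem (operator_mem_operatorSeries hφ ha)
    rwa [h a, inv_mul_cancel, one_eq_zero, add_zero, neg_neg] at h1

theorem mem_operatorSubgroup {n : ℕ} {a : A} :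
    a ∈ operatorSubgroup n ↔ a ∈ operatorSeries A n := Iff.rfl

theorem mul_inv_mem_operatorSeries (hA : IsTwoSided A) {n : ℕ} {z w : A}
    (h : z - w ∈ operatorSeries A n) : z * w⁻¹ ∈ operatorSeries A n := by
  obtain ⟨φ, hφ, hw⟩ := exists_operator_right hA w⁻¹
  have h1 := operator_mem_operatorSeries hφ h
  rw [hw] at h1
  have e : z * w⁻¹ = (z - w) * w⁻¹ - w⁻¹ := by
    conv_lhs => rw [← sub_add_cancel z w]
    rw [hA, mul_inv_cancel, one_eq_zero, add_zero]
  rwa [e]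

open scoped commutatorElement in
theorem isDescendingCentralSeries_operatorSubgroup (hA : IsTwoSided A) :
    Subgroup.IsDescendingCentralSeries (operatorSubgroup : ℕ → Subgroup A) := by
  refine ⟨eq_top_iff.2 fun x _ => trivial, fun x n hx g => ?_⟩
  rw [mem_operatorSubgroup] at hx ⊢
  have e : (⁅x, g⁆ : A) = (x * g) * (g * x)⁻¹ := by
    rw [commutatorElement_def, mul_inv_rev]; simp only [mul_assoc]
  rw [e]
  refine mul_inv_mem_operatorSeries hA ?_
  have h₁ := conj_mem_operatorSeries (star_right_mem_operatorSeries hA hx g) x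
  have h₂ := commutator_mem_operatorSeries hx g
  have h₃ := conj_mem_operatorSeries
    ((operatorSeries A (n + 1)).neg_mem (star_left_mem_operatorSeries hx g)) g
  have h := (operatorSeries A (n + 1)).add_mem ((operatorSeries A (n + 1)).add_mem h₁ h₂) h₃
  have e' : x + star x g + -x + (x + g + -x + -g) + (g + -star g x + -g) = x * g - g * x := by
    simp only [star, sub_eq_add_neg, neg_add_rev, neg_neg, add_assoc, neg_add_cancel_left,
      add_neg_cancel_left, add_neg_cancel, add_zero]
  rwa [e'] at h

theorem strongSeries_le_operatorSeries (hA : IsTwoSided A) (k : ℕ) :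
    ∀ m, 2 ^ k ≤ m + 1 → strongSeries A m ≤ operatorSeries A k := by
  induction k with
  | zero => intro m _; exact le_top
  | succ k ih =>
    intro m hm
    have h2 : 1 ≤ 2 ^ k := Nat.one_le_two_pow
    rw [pow_succ] at hm
    obtain _ | m := m
    · omega
    rw [strongSeries, AddSubgroup.closure_le]
    refine Set.iUnion_subset fun i => ?_
    rw [SetLike.coe_subset_coe, starSubgroup, AddSubgroup.closure_le]
    rintro _ ⟨x, hx, y, hy, rfl⟩
    by_cases hi : 2 ^ k ≤ i.1 + 1
    · exact star_right_mem_operatorSeries hA (ih _ hi hx) y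
    · have := i.2
      exact star_left_mem_operatorSeries (ih (m - i.1) (by omega) hy) x

end Chain

open AbelianQuotient in
theorem exists_operatorSeries_eq_bot {A : Type*} [SkewBrace A] (hA : IsTwoSided A)
    (hmax : WellFoundedGT (AddSubgroup A) ∨ WellFoundedGT (Subgroup A))
    (hnil : AddGroup.IsNilpotent A) : ∃ n, operatorSeries A n = ⊥ := by
  let _ := nonUnitalRing hA
  have h_proj : ∀ a b : A, proj a * proj b = proj (a * b) - proj a - proj b := mulHom_proj hA
  let j : A →+ Unitization ℤ (AbelianQuotient A) :=
    AddMonoidHom.comp ⟨⟨Unitization.inr, Unitization.inr_zero ℤ⟩, Unitization.inr_add ℤ⟩ proj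
  have hj' : ∀ a, j a = (proj a : Unitization ℤ (AbelianQuotient A)) := fun _ => rfl
  have hj : ∀ a b, j (a * b) = j a + j b + j a * j b := by
    intro a b
    simp only [hj']
    rw [← Unitization.inr_mul, ← Unitization.inr_add, ← Unitization.inr_add, h_proj]
    congr 1
    abel
  let J : Ideal (Unitization ℤ (AbelianQuotient A)) :=
    RingHom.ker (Unitization.fstHom ℤ (AbelianQuotient A))
  have hJ2 : J.IsTwoSided := inferInstance
  have hE : ∀ c : Unitization ℤ (AbelianQuotient A), ∃ b, c = (c.fst : ℤ) + j b := by
    intro c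
    obtain ⟨b, hb⟩ := proj_surjective c.snd
    refine ⟨b, ?_⟩
    have hn := eq_intCast (Unitization.inlRingHom ℤ (AbelianQuotient A)) c.fst
    rw [hj', hb, ← hn]
    exact (Unitization.inl_fst_add_inr_snd_eq c).symm
  have hJ : ∀ x, x ∈ J ↔ ∃ b, j b = x := by
    intro x
    constructor
    · intro hx
      obtain ⟨b, hb⟩ := hE x
      have h0 : x.fst = 0 := hx
      exact ⟨b, by rw [hb, h0, Int.cast_zero, zero_add]⟩
    · rintro ⟨b, rfl⟩
      exact Unitization.fst_inr ℤ (proj b)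
  obtain ⟨n, hn⟩ := exists_pow_eq_bot j hj hmax hJ fun c => ⟨c.fst, hE c⟩
  have hjJ : ∀ a, j a ∈ J := fun a => (hJ _).2 ⟨a, rfl⟩
  have hle : ∀ k, operatorSeries A k ≤ (Submodule.toAddSubgroup
      (R := Unitization ℤ (AbelianQuotient A)) (J ^ k)).comap j := by
    intro k
    induction k with
    | zero =>
      intro a _
      show j a ∈ J ^ 0
      rw [Submodule.pow_zero, Ideal.one_eq_top]; trivial
    | succ k ih =>
      rw [operatorSeries_succ, AddSubgroup.opCommutator, AddSubgroup.closure_le]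
      rintro _ ⟨φ, hφ, x, hx, rfl⟩
      have hx' : j x ∈ J ^ k := ih hx
      show j (φ x - x) ∈ J ^ (k + 1)
      rcases hφ with ⟨a, ha⟩ | ⟨a, ha⟩ | ⟨g, hg⟩
      · rw [ha, map_sub, map_add, map_neg, hj, Ideal.IsTwoSided.pow_succ]
        convert Ideal.mul_mem_mul (hjJ a) hx' using 1
        abel
      · rw [ha, map_sub, map_sub, hj, Submodule.pow_succ]
        convert Ideal.mul_mem_mul hx' (hjJ a) using 1
        abel
      · rw [hg, map_sub, map_add, map_add, map_neg]
        convert (J ^ (k + 1)).zero_mem using 1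
        abel
  refine AddSubgroup.exists_iterate_opCommutator_eq_bot (N := n) (fun g x => ?_) hnil ?_
  · obtain ⟨φ, hφ, h⟩ := exists_operator_conj g
    exact ⟨φ, hφ, h x⟩
  · intro a ha
    have h : j a ∈ J ^ n := hle n ha
    rw [hn, Submodule.mem_bot, hj', ← Unitization.inr_zero ℤ, Unitization.inr_inj] at h
    exact proj_eq_zero.1 h

end SkewBrace

/-- The maximum condition on subgroups (no infinite strictly ascending chain of subgroups) is
expressed by `WellFoundedGT`; it is assumed for at least one of the two groups. -/
theorem mainTheorem10 (A : Type*) [SkewBrace A] (hA : SkewBrace.IsTwoSided A)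
    (hmax : WellFoundedGT (AddSubgroup A) ∨ WellFoundedGT (Subgroup A))
    (hnil : AddGroup.IsNilpotent A) :
    Group.IsNilpotent A ∧ SkewBrace.IsStronglyNilpotent A := by
  obtain ⟨n, hn⟩ := SkewBrace.exists_operatorSeries_eq_bot hA hmax hnil
  refine ⟨Subgroup.nilpotent_iff_finite_descending_central_series _ |>.2
    ⟨n, SkewBrace.operatorSubgroup, SkewBrace.isDescendingCentralSeries_operatorSubgroup hA, ?_⟩,
    2 ^ n, le_bot_iff.1 (hn ▸ SkewBrace.strongSeries_le_operatorSeries hA n _ (Nat.le_succ _))⟩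
  rw [eq_bot_iff]
  intro x hx
  rw [SkewBrace.mem_operatorSubgroup, hn, AddSubgroup.mem_bot] at hx
  rw [Subgroup.mem_bot, hx, SkewBrace.one_eq_zero]
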